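/- Let $n\ge 0$ be an integer, and let $a<0$ and $\beta>-1$ be real numbers. For $\alpha>-1$, the diagonal Jacobi-Laguerre multiple orthogonal polynomial $L_{n,n}^{(\alpha,\beta)}(x;a)$ is the monic real polynomial of degree $2n$ such that, for $k=0,\ldots,n-1$, $$\int_a^0 x^k L_{n,n}^{(\alpha,\beta)}(x;a)\,(x-a)^{\alpha}|x|^{\beta}e^{-x}\,dx=0 \quad\text{and}\quad \int_0^{\infty} x^k L_{n,n}^{(\alpha,\beta)}(x;a)\,(x-a)^{\alpha}x^{\beta}e^{-x}\,dx=0 .$$ For every $\alpha>-1$ this polynomial exists and is unique, and it has $2n$ distinct real zeros $x_{n,1}(\alpha)<x_{n,2}(\alpha)<\cdots<x_{n,2n}(\alpha)$. For every $j=1,\ldots,2n$, the zero $x_{n,j}(\alpha)$ is a strictly increasing function of $\alpha$ on $(-1,\infty)$. -/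

import Mathlib

open Polynomial

/-- `L` is a Jacobi-Laguerre multiple orthogonal polynomial (of type II) with multi-index `(n, m)`
and parameters `α`, `β`, `a`: it is monic of degree `n + m`, and it is orthogonal to `1, …, x^(n-1)`
for the weight `(x - a)^α |x|^β e^(-x)` on `[a, 0]`, and to `1, …, x^(m-1)` for the weight
`(x - a)^α x^β e^(-x)` on `[0, ∞)`. For `a < 0` and `α, β > -1` every integrand below is
integrable. -/
structure IsJacobiLaguerre (n m : ℕ) (α β a : ℝ) (L : ℝ[X]) : Prop where
  monic : L.Monic
  natDegree_eq : L.natDegree = n + m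
  orthogonal_left : ∀ k : ℕ, k < n →
    ∫ x in Set.Icc a 0, x ^ k * L.eval x * ((x - a) ^ α * |x| ^ β * Real.exp (-x)) = 0
  orthogonal_right : ∀ k : ℕ, k < m →
    ∫ x in Set.Ici (0 : ℝ), x ^ k * L.eval x * ((x - a) ^ α * x ^ β * Real.exp (-x)) = 0

/-! Integration by parts links parameter levels. If `P` is the polynomial of index (n, n) for (α+1,
β+1), then differentiating P (x-a)^(α+1) |x|^(β+1) e^(-x) produces, up to sign, `jlRaise α β a P`
times the weight for (α, β). The boundary terms vanish, so `jlRaise` gains one orthogonality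
relation on each interval and two degrees: it is the polynomial of index (n+1, n+1) for (α, β).

By logarithmic differentiation, its zeros away from a, 0 and the zeros y_j of `P` solve (α+1)/(z-a)
+ (β+1)/z + ∑ 1/(z-y_j) = 1. All masses are positive, so each gap between consecutive poles, and the
ray beyond the last, contains a solution (`exists_sum_div_sub_eq_one`); these 2n+2 solutions are all
the zeros. When α grows, the mass at a grows and, by induction on n, the y_j(α+1) move right, while
the poles a and 0 stay fixed. Both effects push each solution to the right (`lt_of_sum_div_sub_eq`).

Uniqueness is the usual count of sign changes (`le_card_of_forall_integral_eq_zero`). -/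

/-! ### Partial fractions with positive residues -/

open Filter Topology in
-- The sum tends to +∞ to the right of each pole. It tends to -∞ to the left of the next one, or to
-- 0 < 1 at infinity after the last, so it takes the value 1 in between.
theorem exists_sum_div_sub_eq_one {N : ℕ} {p m : ℕ → ℝ} (hp : StrictMonoOn p (Set.Iio N))
    (hm : ∀ j < N, 0 < m j) {i : ℕ} (hi : i < N) :
    ∃ z, p i < z ∧ (i + 1 < N → z < p (i + 1)) ∧
      ∑ j ∈ Finset.range N, m j / (z - p j) = 1 := by
  have cont : ∀ (s : Finset ℕ) (t : Set ℝ), (∀ x ∈ t, ∀ j ∈ s, x ≠ p j) →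
      ContinuousOn (fun x => ∑ j ∈ s, m j / (x - p j)) t := fun s t h =>
    continuousOn_finsetSum _ fun j hj => ContinuousOn.div (by fun_prop) (by fun_prop)
      fun x hx => sub_ne_zero.2 (h x hx j hj)
  have near : ∀ k < N, ContinuousAt
      (fun x => ∑ j ∈ (Finset.range N).erase k, m j / (x - p j)) (p k) := by
    intro k hk
    refine tendsto_finsetSum _ fun j hj => ?_
    have hj' := Finset.mem_erase.1 hj
    have : p k - p j ≠ 0 := sub_ne_zero.2 fun h =>
      hj'.1 (hp.injOn (Finset.mem_range.1 hj'.2) hk h.symm)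
    exact Tendsto.div tendsto_const_nhds (tendsto_id.sub_const _) this
  have split : ∀ k < N, (fun x => ∑ j ∈ Finset.range N, m j / (x - p j)) =
      fun x => m k / (x - p k) + ∑ j ∈ (Finset.range N).erase k, m j / (x - p j) := by
    intro k hk
    funext x
    rw [Finset.add_sum_erase _ (fun j => m j / (x - p j)) (Finset.mem_range.2 hk)]
  have top : Tendsto (fun x => ∑ j ∈ Finset.range N, m j / (x - p j)) (𝓝[>] (p i)) atTop := by
    rw [split i hi]
    refine Tendsto.atTop_add ?_ ((near i hi).tendsto.mono_left nhdsWithin_le_nhds)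
    simp only [div_eq_mul_inv]
    refine Tendsto.const_mul_atTop (hm i hi) (tendsto_inv_nhdsGT_zero.comp ?_)
    refine tendsto_nhdsWithin_iff.2 ⟨?_, ?_⟩
    · have : ContinuousAt (fun x => x - p i) (p i) := by fun_prop
      simpa using this.tendsto.mono_left nhdsWithin_le_nhds
    · filter_upwards [self_mem_nhdsWithin] with x hx
      exact sub_pos.2 (Set.mem_Ioi.1 hx)
  by_cases h : i + 1 < N
  · have bot : Tendsto (fun x => ∑ j ∈ Finset.range N, m j / (x - p j))
        (𝓝[<] (p (i + 1))) atBot := by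
      rw [split _ h]
      refine Tendsto.atBot_add ?_ ((near _ h).tendsto.mono_left nhdsWithin_le_nhds)
      simp only [div_eq_mul_inv]
      refine Tendsto.const_mul_atBot (hm _ h) (tendsto_inv_nhdsLT_zero.comp ?_)
      refine tendsto_nhdsWithin_iff.2 ⟨?_, ?_⟩
      · have : ContinuousAt (fun x => x - p (i + 1)) (p (i + 1)) := by fun_prop
        simpa using this.tendsto.mono_left nhdsWithin_le_nhds
      · filter_upwards [self_mem_nhdsWithin] with x hx
        exact sub_neg.2 (Set.mem_Iio.1 hx)
    have hlt : p i < p (i + 1) := hp hi h (Nat.lt_succ_self i)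
    have hc := cont (Finset.range N) (Set.Ioo (p i) (p (i + 1))) (by
      rintro x ⟨hx1, hx2⟩ j hj rfl
      have hj := Finset.mem_range.1 hj
      have h1 := (hp.lt_iff_lt hi hj).1 hx1
      have h2 := (hp.lt_iff_lt hj h).1 hx2
      omega)
    have := isPreconnected_Ioo.intermediate_value_Iii
      (l₁ := 𝓝[<] (p (i + 1))) (l₂ := 𝓝[>] (p i))
      (by rw [← nhdsWithin_Ioo_eq_nhdsLT hlt]; exact inf_le_right)
      (by rw [← nhdsWithin_Ioo_eq_nhdsGT hlt]; exact inf_le_right) hc bot top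
    obtain ⟨z, hz, hz1⟩ := this (Set.mem_univ 1)
    exact ⟨z, hz.1, fun _ => hz.2, hz1⟩
  · have zero : Tendsto (fun x => ∑ j ∈ Finset.range N, m j / (x - p j)) atTop (𝓝 0) := by
      rw [← Finset.sum_const_zero (s := Finset.range N)]
      refine tendsto_finsetSum _ fun j _ => ?_
      exact Tendsto.div_atTop tendsto_const_nhds (tendsto_atTop_add_const_right _ _ tendsto_id)
    have hc := cont (Finset.range N) (Set.Ioi (p i)) (by
      rintro x hx1 j hj rfl
      have hj := Finset.mem_range.1 hj
      have h1 := (hp.lt_iff_lt hi hj).1 hx1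
      omega)
    have := isPreconnected_Ioi.intermediate_value_Ioi (l₁ := atTop) (l₂ := 𝓝[>] (p i))
      (le_principal_iff.2 (Ioi_mem_atTop _)) inf_le_right hc zero top
    obtain ⟨z, hz, hz1⟩ := this (Set.mem_Ioi.2 one_pos)
    exact ⟨z, hz, fun h' => absurd h' h, hz1⟩

/-- If z' ≤ z, then z' - p' j ≤ z - p j with both sides of the same sign, so no term decreases on
passing to the primed data. The pole 0 always lies to the left of z', so its larger mass makes the
inequality of sums strict. -/
theorem lt_of_sum_div_sub_eq {N : ℕ} {p m p' m' : ℕ → ℝ} (hp : StrictMonoOn p (Set.Iio N))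
    (hp' : StrictMonoOn p' (Set.Iio N)) (hm : ∀ j < N, 0 < m j)
    (hle : ∀ j < N, p j ≤ p' j) (h0 : m 0 < m' 0) (hm' : ∀ j, 0 < j → m j = m' j)
    {i : ℕ} (hi : i < N) {z z' c : ℝ} (hzi : i + 1 < N → z < p (i + 1))
    (hz' : p' i < z')
    (hs : ∑ j ∈ Finset.range N, m j / (z - p j) = c)
    (hs' : ∑ j ∈ Finset.range N, m' j / (z' - p' j) = c) : z < z' := by
  by_contra! hcon
  refine absurd (hs.trans hs'.symm) (ne_of_lt ?_)
  have left : ∀ j ≤ i, 0 < z' - p' j ∧ z' - p' j ≤ z - p j := by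
    intro j hj
    have h1 : p' j ≤ p' i := hp'.monotoneOn (show j < N by omega) hi hj
    have h2 := hle j (by omega)
    exact ⟨by linarith, by linarith⟩
  have right : ∀ j < N, i < j → z - p j < 0 ∧ z' - p' j ≤ z - p j := by
    intro j hj hij
    have h1 := hzi (by omega)
    have h2 : p (i + 1) ≤ p j := hp.monotoneOn (show i + 1 < N by omega) hj (by omega)
    have h3 := hle j hj
    exact ⟨by linarith, by linarith⟩
  refine Finset.sum_lt_sum (fun j hj => ?_) ⟨0, Finset.mem_range.2 (by omega), ?_⟩
  · have hj := Finset.mem_range.1 hj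
    have hmj : m j ≤ m' j := by
      rcases Nat.eq_zero_or_pos j with rfl | h
      exacts [h0.le, (hm' j h).le]
    rcases le_or_gt j i with hji | hji
    · exact div_le_div₀ ((hm j hj).le.trans hmj) hmj (left j hji).1 (left j hji).2
    · rw [← hm' j (by omega), div_eq_mul_inv, div_eq_mul_inv]
      have hr := right j hj hji
      exact mul_le_mul_of_nonneg_left ((inv_le_inv_of_neg hr.1 (hr.2.trans_lt hr.1)).2 hr.2)
        (hm j hj).le
  · have hl := left 0 (Nat.zero_le i)
    exact (div_le_div_of_nonneg_left (hm 0 (by omega)).le hl.1 hl.2).trans_lt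
      (div_lt_div_of_pos_right h0 hl.1)

/-! ### The weight, its integrability, and the raising operator -/

section

open MeasureTheory

/-- The Jacobi-Laguerre weight `(x - a)^α |x|^β e^(-x)`. -/
noncomputable def jlWeight (α β a x : ℝ) : ℝ := (x - a) ^ α * |x| ^ β * Real.exp (-x)

theorem jlWeight_pos (α β : ℝ) {a x : ℝ} (hx : a < x) (hx0 : x ≠ 0) : 0 < jlWeight α β a x :=
  mul_pos (mul_pos (Real.rpow_pos_of_pos (sub_pos.2 hx) _)
    (Real.rpow_pos_of_pos (abs_pos.2 hx0) _)) (Real.exp_pos _)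

theorem intervalIntegrable_abs_rpow {β : ℝ} (hβ : -1 < β) (b c : ℝ) :
    IntervalIntegrable (fun x : ℝ => |x| ^ β) volume b c := by
  have pos : ∀ c : ℝ, 0 ≤ c → IntervalIntegrable (fun x : ℝ => |x| ^ β) volume 0 c := by
    intro c hc
    refine (intervalIntegral.intervalIntegrable_rpow' hβ (a := 0) (b := c)).congr ?_
    intro x hx
    rw [Set.uIoc_of_le hc] at hx
    simp only [abs_of_pos hx.1]
  have all : ∀ c : ℝ, IntervalIntegrable (fun x : ℝ => |x| ^ β) volume 0 c := by
    intro c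
    rcases le_total 0 c with hc | hc
    · exact pos c hc
    · have := (IntervalIntegrable.iff_comp_neg).1 (pos (-c) (by linarith))
      simpa using this
  exact (all b).symm.trans (all c)

theorem intervalIntegrable_eval_mul_jlWeight {α β a : ℝ} (ha : a < 0) (hα : -1 < α) (hβ : -1 < β)
    (P : ℝ[X]) {c : ℝ} (hc : 0 ≤ c) :
    IntervalIntegrable (fun x => P.eval x * jlWeight α β a x) volume a c := by
  -- The point a/2 separates the possible singularities at a and at 0.
  have h1 : IntervalIntegrable (fun x => P.eval x * jlWeight α β a x) volume a (a / 2) := by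
    have : IntervalIntegrable (fun x : ℝ => (x - a) ^ α) volume a (a / 2) := by
      have := (intervalIntegral.intervalIntegrable_rpow' hα (a := 0) (b := a / 2 - a)).comp_sub_right a
      simpa using this
    refine (this.mul_continuousOn (g := fun x => P.eval x * |x| ^ β * Real.exp (-x)) ?_).congr ?_
    · intro x hx
      rw [Set.uIcc_of_le (by linarith)] at hx
      have : |x| ≠ 0 := abs_ne_zero.2 (by linarith [hx.2])
      refine ContinuousAt.continuousWithinAt ?_
      exact (P.continuous.continuousAt.mul (continuous_abs.continuousAt.rpow_const (Or.inl this))).mul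
        (by fun_prop)
    · intro x _
      simp only [jlWeight]
      ring
  have h2 : IntervalIntegrable (fun x => P.eval x * jlWeight α β a x) volume (a / 2) c := by
    refine ((intervalIntegrable_abs_rpow hβ _ _).mul_continuousOn
      (g := fun x => P.eval x * (x - a) ^ α * Real.exp (-x)) ?_).congr ?_
    · intro x hx
      rw [Set.uIcc_of_le (by linarith)] at hx
      have : x - a ≠ 0 := by linarith [hx.1]
      refine ContinuousAt.continuousWithinAt ?_
      exact (P.continuous.continuousAt.mul
        ((by fun_prop : ContinuousAt (fun x => x - a) x).rpow_const (Or.inl this))).mul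
        (by fun_prop)
    · intro x _
      simp only [jlWeight]
      ring
  exact h1.trans h2

open Filter Asymptotics in
theorem integrableOn_Ioi_eval_mul_jlWeight {α β a : ℝ} (ha : a < 0) (hα : -1 < α) (hβ : -1 < β)
    (P : ℝ[X]) : IntegrableOn (fun x => P.eval x * jlWeight α β a x) (Set.Ioi 0) := by
  rw [← Set.Ioc_union_Ioi_eq_Ioi (zero_le_one' ℝ), integrableOn_union]
  constructor
  · have := intervalIntegrable_eval_mul_jlWeight ha hα hβ P (zero_le_one' ℝ)
    rw [intervalIntegrable_iff_integrableOn_Ioc_of_le (by linarith)] at this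
    exact this.mono_set (Set.Ioc_subset_Ioc_left ha.le)
  -- The polynomial and the two powers are each O(e^(x/4)); against e^(-x) this leaves e^(-x/4).
  · refine integrable_of_isBigO_exp_neg (b := 1 / 4) (by norm_num) ?_ ?_
    · intro x hx
      have hx : (1 : ℝ) ≤ x := hx
      refine ContinuousAt.continuousWithinAt ?_
      have h1 : x - a ≠ 0 := by linarith
      have h2 : |x| ≠ 0 := abs_ne_zero.2 (by linarith)
      exact P.continuous.continuousAt.mul
        ((((by fun_prop : ContinuousAt (fun x => x - a) x).rpow_const (Or.inl h1)).mul
        (continuous_abs.continuousAt.rpow_const (Or.inl h2))).mul (by fun_prop))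
    · have hP : (fun x => P.eval x) =O[atTop] fun x => Real.exp (1 / 4 * x) := by
        have h1 := Polynomial.isBigO_atTop_of_degree_le P (X ^ P.natDegree) (by
          rw [degree_X_pow]; exact degree_le_natDegree)
        simp only [eval_pow, eval_X] at h1
        exact h1.trans (isLittleO_pow_exp_pos_mul_atTop _ (by norm_num)).isBigO
      have hA : (fun x => (x - a) ^ α) =O[atTop] fun x => Real.exp (1 / 4 * x) := by
        have h1 := ((isLittleO_rpow_exp_pos_mul_atTop α (b := 1 / 4) (by norm_num)).comp_tendsto
          (tendsto_atTop_add_const_right atTop (-a) tendsto_id)).isBigO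
        have h2 : (fun x => Real.exp (1 / 4 * (x + -a))) =O[atTop]
            fun x => Real.exp (1 / 4 * x) := by
          have : ∀ x, Real.exp (1 / 4 * (x + -a)) =
              Real.exp (1 / 4 * -a) * Real.exp (1 / 4 * x) := by
            intro x
            rw [← Real.exp_add]
            ring_nf
          simp only [this]
          exact isBigO_const_mul_self _ _ _
        simpa [Function.comp_def, sub_eq_add_neg] using h1.trans h2
      have hB : (fun x : ℝ => |x| ^ β) =O[atTop] fun x => Real.exp (1 / 4 * x) := by
        refine (isLittleO_rpow_exp_pos_mul_atTop β (b := 1 / 4) (by norm_num)).isBigO.congr' ?_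
          EventuallyEq.rfl
        filter_upwards [eventually_gt_atTop 0] with x hx
        rw [abs_of_pos hx]
      refine (hP.mul ((hA.mul hB).mul (isBigO_refl (fun x => Real.exp (-x)) atTop))).congr_right ?_
      intro x
      rw [← Real.exp_add, ← Real.exp_add, ← Real.exp_add]
      ring_nf

/-- The raising operator: up to the sign of `x`, the polynomial `Q` with
`d/dx [P (x - a)^(α+1) |x|^(β+1) e^(-x)] = -Q (x - a)^α |x|^β e^(-x)`. -/
noncomputable def jlRaise (α β a : ℝ) (P : ℝ[X]) : ℝ[X] :=
  X * (X - C a) * P - (C (α + 1) * X + C (β + 1) * (X - C a)) * P - X * (X - C a) * derivative P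

/-- Here σ is the sign of x, so that both half-lines are treated at once. -/
theorem hasDerivAt_eval_mul_jlWeight {α β a x σ : ℝ} (hx : a < x)
    (hx0 : x ≠ 0) (hσ : HasDerivAt (fun x : ℝ => |x|) σ x) (hxσ : |x| = σ * x) (P : ℝ[X]) :
    HasDerivAt (fun x => P.eval x * jlWeight (α + 1) (β + 1) a x)
      (-σ * ((jlRaise α β a P).eval x * jlWeight α β a x)) x := by
  have hxa : x - a ≠ 0 := sub_ne_zero.2 hx.ne'
  have h1 := ((hasDerivAt_id x).sub_const a).rpow_const (p := α + 1) (Or.inl hxa)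
  have h2 := hσ.rpow_const (p := β + 1) (Or.inl (abs_ne_zero.2 hx0))
  have h3 := (hasDerivAt_neg x).exp
  refine ((P.hasDerivAt x).mul ((h1.mul h2).mul h3)).congr_deriv ?_
  simp only [jlRaise, jlWeight, eval_sub, eval_mul, eval_add, eval_X, eval_C, id,
    Real.rpow_add_one hxa, Real.rpow_add_one (abs_ne_zero.2 hx0), add_sub_cancel_right,
    Pi.mul_apply]
  rw [hxσ]
  ring

theorem continuousOn_eval_mul_jlWeight {α β a : ℝ} (hα : 0 ≤ α) (hβ : 0 ≤ β) (P : ℝ[X])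
    (s : Set ℝ) : ContinuousOn (fun x => P.eval x * jlWeight α β a x) s := by
  refine Continuous.continuousOn ?_
  unfold jlWeight
  exact P.continuous.mul ((((continuous_sub_right a).rpow_const fun _ => Or.inr hα).mul
    (continuous_abs.rpow_const fun _ => Or.inr hβ)).mul (by fun_prop))

theorem integral_Ioc_jlRaise_mul_jlWeight {α β a : ℝ} (ha : a < 0) (hα : -1 < α) (hβ : -1 < β)
    (P : ℝ[X]) : ∫ x in Set.Ioc a 0, (jlRaise α β a P).eval x * jlWeight α β a x = 0 := by
  rw [← intervalIntegral.integral_of_le ha.le,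
    intervalIntegral.integral_eq_sub_of_hasDerivAt_of_le ha.le
    (continuousOn_eval_mul_jlWeight (α := α + 1) (β := β + 1) (a := a) (by linarith) (by linarith)
      P _) (fun x hx => ?_) (intervalIntegrable_eval_mul_jlWeight ha hα hβ _ le_rfl)]
  · have h1 : (0 : ℝ) ^ (α + 1) = 0 := Real.zero_rpow (by linarith)
    have h2 : (0 : ℝ) ^ (β + 1) = 0 := Real.zero_rpow (by linarith)
    simp [jlWeight, h1, h2]
  · have := hasDerivAt_eval_mul_jlWeight (α := α) (β := β) hx.1 hx.2.ne (hasDerivAt_abs_neg hx.2)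
      (by rw [abs_of_neg hx.2]; ring) P
    simpa using this

theorem integral_Ioi_jlRaise_mul_jlWeight {α β a : ℝ} (ha : a < 0) (hα : -1 < α) (hβ : -1 < β)
    (P : ℝ[X]) : ∫ x in Set.Ioi 0, (jlRaise α β a P).eval x * jlWeight α β a x = 0 := by
  have hderiv : ∀ x ∈ Set.Ioi (0 : ℝ), HasDerivAt
      (fun x => P.eval x * jlWeight (α + 1) (β + 1) a x)
      (-((jlRaise α β a P).eval x * jlWeight α β a x)) x := by
    intro x hx
    have hx : 0 < x := hx
    have := hasDerivAt_eval_mul_jlWeight (α := α) (β := β) (ha.trans hx) hx.ne'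
      (hasDerivAt_abs_pos hx) (by rw [abs_of_pos hx]; ring) P
    simpa using this
  have hint := (integrableOn_Ioi_eval_mul_jlWeight ha hα hβ (jlRaise α β a P)).neg
  -- The function and its derivative are both integrable, so the limit at infinity is 0.
  have hlim := tendsto_zero_of_hasDerivAt_of_integrableOn_Ioi hderiv hint
    (integrableOn_Ioi_eval_mul_jlWeight ha (by linarith) (by linarith) P)
  have := integral_Ioi_of_hasDerivAt_of_tendsto
    ((continuousOn_eval_mul_jlWeight (α := α + 1) (β := β + 1) (a := a) (by linarith) (by linarith)
      P (Set.Ici 0)) 0 Set.self_mem_Ici) hderiv hint hlim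
  have h2 : (0 : ℝ) ^ (β + 1) = 0 := Real.zero_rpow (by linarith)
  rw [integral_neg] at this
  simpa [jlWeight, h2] using this

/-- The operator is of first order, so by the Leibniz rule it commutes with multiplication by a
power up to a term without derivative. -/
theorem jlRaise_X_pow_succ_mul (α β a : ℝ) (P : ℝ[X]) (k : ℕ) :
    X ^ (k + 1) * jlRaise α β a P = jlRaise α β a (X ^ (k + 1) * P) +
      C (k + 1 : ℝ) * (X ^ k * P * (X * (X - C a))) := by
  have h : derivative (X ^ (k + 1) : ℝ[X]) = C (k + 1 : ℝ) * X ^ k := by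
    simp
  simp only [jlRaise, derivative_mul, h]
  ring

theorem mul_sub_mul_jlWeight {α β a x : ℝ} (hα : -1 < α) (hβ : -1 < β) (hx : a ≤ x) :
    |x| * (x - a) * jlWeight α β a x = jlWeight (α + 1) (β + 1) a x := by
  rw [jlWeight, jlWeight, Real.rpow_add_one' (sub_nonneg.2 hx) (by linarith),
    Real.rpow_add_one' (abs_nonneg x) (by linarith)]
  ring

/-- By the commutation rule each moment of positive order splits into the integral of a raised
polynomial, which is 0, and a multiple of a moment of `P` one order lower for the raised weight. The
moment of order 0 is itself the integral of a raised polynomial, whence the extra relation. -/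
theorem integral_pow_mul_jlRaise {α β a σ : ℝ} {J : Set ℝ} (hJ : MeasurableSet J)
    (hα : -1 < α) (hβ : -1 < β)
    (haJ : ∀ x ∈ J, a ≤ x) (hσ : σ * σ = 1) (hσJ : ∀ x ∈ J, |x| = σ * x)
    (hint : ∀ P : ℝ[X], IntegrableOn (fun x => P.eval x * jlWeight α β a x) J)
    (hraise : ∀ P : ℝ[X], ∫ x in J, (jlRaise α β a P).eval x * jlWeight α β a x = 0)
    {P : ℝ[X]} {n : ℕ}
    (horth : ∀ k < n, ∫ x in J, x ^ k * P.eval x * jlWeight (α + 1) (β + 1) a x = 0) :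
    ∀ k < n + 1, ∫ x in J, x ^ k * (jlRaise α β a P).eval x * jlWeight α β a x = 0 := by
  rintro (_ | k) hk
  · simpa using hraise P
  · have key : ∀ x ∈ J, x ^ (k + 1) * (jlRaise α β a P).eval x * jlWeight α β a x =
        (jlRaise α β a (X ^ (k + 1) * P)).eval x * jlWeight α β a x +
        (k + 1) * σ * (x ^ k * P.eval x * jlWeight (α + 1) (β + 1) a x) := by
      intro x hx
      have h1 := congrArg (eval x) (jlRaise_X_pow_succ_mul α β a P k)
      rw [eval_mul, eval_pow, eval_X, eval_add] at h1
      rw [h1, ← mul_sub_mul_jlWeight hα hβ (haJ x hx)]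
      simp only [eval_mul, eval_C, eval_pow, eval_X, eval_sub, hσJ x hx]
      linear_combination (-(k + 1 : ℝ) * x ^ k * P.eval x * x * (x - a) * jlWeight α β a x) * hσ
    rw [setIntegral_congr_fun hJ key, integral_add (hint _), hraise, integral_const_mul,
      horth k (by omega)]
    · simp
    · refine Integrable.const_mul ?_ _
      refine (hint (X ^ k * P * (C σ * (X * (X - C a))))).congr_fun (fun x hx => ?_) hJ
      simp only [← mul_sub_mul_jlWeight hα hβ (haJ x hx), hσJ x hx, eval_mul, eval_C, eval_pow,
        eval_X, eval_sub]
      ring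

end

/-! ### Sign changes and uniqueness -/

/-- Multiplying by one linear factor for each root of odd multiplicity in the interval removes all
sign changes. In the induction, splitting off a root toggles its membership in `s`. -/
theorem exists_mul_prod_eval_sign (I : Set ℝ) (hI : IsPreconnected I) (D : ℝ[X]) (hD : D ≠ 0) :
    ∃ s : Multiset ℝ, s ≤ D.roots ∧ (∀ r ∈ s, r ∈ I) ∧
      ((∀ x ∈ I, 0 ≤ D.eval x * (s.map (X - C ·)).prod.eval x) ∨
        (∀ x ∈ I, D.eval x * (s.map (X - C ·)).prod.eval x ≤ 0)) := by
  induction h : D.natDegree generalizing D with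
  | zero => 
    rw [Polynomial.eq_C_of_natDegree_eq_zero h]
    refine ⟨0, by simp, by simp, ?_⟩
    rcases le_total 0 (D.coeff 0) with h | h <;> simp [h]
  | succ d ih =>
    by_cases hr : ∃ r ∈ I, D.IsRoot r
    · obtain ⟨r, hrI, hr⟩ := hr
      obtain ⟨E, rfl⟩ := dvd_iff_isRoot.2 hr
      have hE : E ≠ 0 := right_ne_zero_of_mul hD
      have hdeg : E.natDegree = d := by
        rw [natDegree_mul (X_sub_C_ne_zero r) hE, natDegree_X_sub_C] at h
        omega
      obtain ⟨s, hs, hsI, hsign⟩ := ih E hE hdeg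
      have hroots : ((X - C r) * E).roots = r ::ₘ E.roots := by
        rw [roots_mul hD, roots_X_sub_C, Multiset.singleton_add]
      by_cases hrs : r ∈ s
      · obtain ⟨t, rfl⟩ := Multiset.exists_cons_of_mem hrs
        refine ⟨t, ?_, fun x hx => hsI x (Multiset.mem_cons_of_mem hx), ?_⟩
        · rw [hroots]
          exact ((Multiset.le_cons_self t r).trans hs).trans (Multiset.le_cons_self _ r)
        · have key : ∀ x, ((X - C r) * E).eval x * (t.map (X - C ·)).prod.eval x =
              E.eval x * ((r ::ₘ t).map (X - C ·)).prod.eval x := by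
            intro x
            simp only [Multiset.map_cons, Multiset.prod_cons, eval_mul]
            ring
          simpa only [key] using hsign
      · refine ⟨r ::ₘ s, ?_, ?_, ?_⟩
        · rw [hroots]
          exact Multiset.cons_le_cons r hs
        · intro x hx
          rcases Multiset.mem_cons.1 hx with rfl | hx
          exacts [hrI, hsI x hx]
        · have key : ∀ x, ((X - C r) * E).eval x * ((r ::ₘ s).map (X - C ·)).prod.eval x =
              (x - r) ^ 2 * (E.eval x * (s.map (X - C ·)).prod.eval x) := by
            intro x
            simp only [Multiset.map_cons, Multiset.prod_cons, eval_mul, eval_sub, eval_X, eval_C]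
            ring
          simp only [key]
          refine hsign.imp (fun H x hx => mul_nonneg (sq_nonneg _) (H x hx))
            (fun H x hx => mul_nonpos_of_nonneg_of_nonpos (sq_nonneg _) (H x hx))
    · refine ⟨0, by simp, by simp, ?_⟩
      by_contra! hcon
      obtain ⟨⟨x, hx, hx0⟩, ⟨y, hy, hy0⟩⟩ := hcon
      simp only [Multiset.map_zero, Multiset.prod_zero, eval_one, mul_one] at hx0 hy0
      obtain ⟨z, hz, hz0⟩ := hI.intermediate_value hx hy (f := fun x => D.eval x)
        (by fun_prop) ⟨hx0.le, hy0.le⟩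
      exact hr ⟨z, hz, hz0⟩

section

open MeasureTheory

/-- A nonzero polynomial orthogonal to all
polynomials of degree `< n` has at least `n` roots in the interval. -/
theorem le_card_of_forall_integral_eq_zero {I J : Set ℝ} (hI : IsPreconnected I) (hIo : IsOpen I)
    (hne : I.Nonempty) (hJ : J =ᵐ[volume] I)
    {w : ℝ → ℝ} (hw : ∀ x ∈ I, 0 < w x)
    (hint : ∀ P : ℝ[X], IntegrableOn (fun x => P.eval x * w x) J)
    {n : ℕ} {D : ℝ[X]} (hD : D ≠ 0)
    (horth : ∀ k < n, ∫ x in J, x ^ k * D.eval x * w x = 0) :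
    ∃ s : Multiset ℝ, s ≤ D.roots ∧ (∀ r ∈ s, r ∈ I) ∧ n ≤ Multiset.card s := by
  obtain ⟨s, hs, hsI, hsign⟩ := exists_mul_prod_eval_sign I hI D hD
  refine ⟨s, hs, hsI, ?_⟩
  by_contra! hlt
  set q : ℝ[X] := (s.map (X - C ·)).prod with hq
  have hqd : q.natDegree = Multiset.card s := natDegree_multiset_prod_X_sub_C_eq_card s
  have hqm : q.Monic := monic_multiset_prod_of_monic _ _ fun r _ => monic_X_sub_C r
  -- `q` has degree below n, so orthogonality makes this integral 0. The integrand has constant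
  -- sign, hence vanishes almost everywhere, although D * q has only finitely many roots.
  have hzero : ∫ x in I, D.eval x * q.eval x * w x = 0 := by
    rw [← setIntegral_congr_set hJ]
    have : ∀ x, D.eval x * q.eval x * w x =
        ∑ k ∈ Finset.range (q.natDegree + 1), q.coeff k * (x ^ k * D.eval x * w x) := by
      intro x
      rw [eval_eq_sum_range (p := q), Finset.mul_sum, Finset.sum_mul]
      exact Finset.sum_congr rfl fun k _ => by ring
    simp only [this]
    rw [integral_finsetSum]
    · refine Finset.sum_eq_zero fun k hk => ?_
      rw [integral_const_mul, horth k (by have := Finset.mem_range.1 hk; omega), mul_zero]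
    · intro k _
      refine Integrable.const_mul ?_ _
      have h := hint ((X : ℝ[X]) ^ k * D)
      simp only [eval_mul, eval_pow, eval_X] at h
      exact h
  have hIint : IntegrableOn (fun x => D.eval x * q.eval x * w x) I := by
    rw [← integrableOn_congr_set_ae hJ]
    simpa using hint (D * q)
  have hae : ∀ᵐ x ∂(volume.restrict I), D.eval x * q.eval x * w x = 0 := by
    rcases hsign with H | H
    · refine (integral_eq_zero_iff_of_nonneg_ae ?_ hIint).1 hzero
      filter_upwards [ae_restrict_mem hIo.measurableSet] with x hx
      exact mul_nonneg (H x hx) (hw x hx).le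
    · have := (integral_eq_zero_iff_of_nonneg_ae (f := fun x => -(D.eval x * q.eval x * w x))
        (μ := volume.restrict I) ?_ hIint.neg).1 (by rw [integral_neg, hzero, neg_zero])
      · filter_upwards [this] with x hx
        simpa using hx
      · filter_upwards [ae_restrict_mem hIo.measurableSet] with x hx
        have := mul_nonpos_of_nonpos_of_nonneg (H x hx) (hw x hx).le
        simpa using this
  have hfin : volume I = 0 := by
    rw [ae_restrict_iff' hIo.measurableSet] at hae
    refine measure_mono_null (t := {x | ¬ (x ∈ I → D.eval x * q.eval x * w x = 0)} ∪
      ((D * q).roots.toFinset : Set ℝ)) ?_ (measure_union_null hae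
        (Finset.measure_zero _ _))
    intro x hx
    by_cases h0 : (D * q).eval x = 0
    · right
      simpa [hD, hqm.ne_zero] using h0
    · left
      intro hcon
      have := hcon hx
      rw [← eval_mul] at this
      exact (mul_ne_zero h0 (hw x hx).ne') this
  exact (hIo.measure_pos volume hne).ne' hfin

end

section

open MeasureTheory

theorem isJacobiLaguerre_iff {n m : ℕ} {α β a : ℝ} {L : ℝ[X]} :
    IsJacobiLaguerre n m α β a L ↔ L.Monic ∧ L.natDegree = n + m ∧
      (∀ k < n, ∫ x in Set.Ioc a 0, x ^ k * L.eval x * jlWeight α β a x = 0) ∧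
      ∀ k < m, ∫ x in Set.Ioi 0, x ^ k * L.eval x * jlWeight α β a x = 0 := by
  have h : ∀ k : ℕ, ∫ x in Set.Ici (0 : ℝ), x ^ k * L.eval x *
      ((x - a) ^ α * x ^ β * Real.exp (-x)) =
      ∫ x in Set.Ioi 0, x ^ k * L.eval x * jlWeight α β a x := by
    intro k
    rw [integral_Ici_eq_integral_Ioi]
    refine setIntegral_congr_fun measurableSet_Ioi fun x hx => ?_
    simp only [jlWeight, abs_of_pos (Set.mem_Ioi.1 hx)]
  constructor
  · rintro ⟨h1, h2, h3, h4⟩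
    refine ⟨h1, h2, fun k hk => ?_, fun k hk => ?_⟩
    · rw [← integral_Icc_eq_integral_Ioc]
      exact h3 k hk
    · rw [← h]
      exact h4 k hk
  · rintro ⟨h1, h2, h3, h4⟩
    refine ⟨h1, h2, fun k hk => ?_, fun k hk => ?_⟩
    · rw [integral_Icc_eq_integral_Ioc]
      exact h3 k hk
    · rw [h]
      exact h4 k hk

/-- The difference of two solutions inherits the orthogonality. If nonzero, it would have n roots in
(a, 0) and m in (0, ∞), too many for its degree below n + m. -/
theorem IsJacobiLaguerre.unique {n m : ℕ} {α β a : ℝ} (ha : a < 0) (hα : -1 < α) (hβ : -1 < β)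
    {L M : ℝ[X]} (hL : IsJacobiLaguerre n m α β a L) (hM : IsJacobiLaguerre n m α β a M) :
    L = M := by
  have hdegL := hL.natDegree_eq
  have hdegM := hM.natDegree_eq
  have hmL := hL.monic
  have hmM := hM.monic
  obtain ⟨-, -, hL1, hL2⟩ := isJacobiLaguerre_iff.1 hL
  obtain ⟨-, -, hM1, hM2⟩ := isJacobiLaguerre_iff.1 hM
  by_contra hne
  have hD : L - M ≠ 0 := sub_ne_zero.2 hne
  have hint1 : ∀ P : ℝ[X], IntegrableOn (fun x => P.eval x * jlWeight α β a x) (Set.Ioc a 0) :=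
    fun P => (intervalIntegrable_iff_integrableOn_Ioc_of_le ha.le).1
      (intervalIntegrable_eval_mul_jlWeight ha hα hβ P le_rfl)
  have hint2 := integrableOn_Ioi_eval_mul_jlWeight ha hα hβ
  have sub : ∀ (J : Set ℝ), (∀ P : ℝ[X], IntegrableOn (fun x => P.eval x * jlWeight α β a x) J) →
      ∀ k, ∫ x in J, x ^ k * L.eval x * jlWeight α β a x = 0 →
      ∫ x in J, x ^ k * M.eval x * jlWeight α β a x = 0 →
      ∫ x in J, x ^ k * (L - M).eval x * jlWeight α β a x = 0 := by
    intro J hJ k h1 h2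
    have hi : ∀ P : ℝ[X], IntegrableOn (fun x => x ^ k * P.eval x * jlWeight α β a x) J := by
      intro P
      have h := hJ ((X : ℝ[X]) ^ k * P)
      simp only [eval_mul, eval_pow, eval_X] at h
      exact h
    have := integral_sub (hi L) (hi M)
    rw [h1, h2, sub_zero] at this
    rw [← this]
    congr 1
    funext x
    rw [eval_sub]
    ring
  obtain ⟨s, hs, hsI, hsn⟩ := le_card_of_forall_integral_eq_zero (I := Set.Ioo a 0)
    isPreconnected_Ioo isOpen_Ioo (Set.nonempty_Ioo.2 ha) Ioo_ae_eq_Ioc.symm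
    (fun x hx => jlWeight_pos α β hx.1 hx.2.ne) hint1 hD
    (fun k hk => sub _ hint1 k (hL1 k hk) (hM1 k hk))
  obtain ⟨t, ht, htI, htn⟩ := le_card_of_forall_integral_eq_zero (I := Set.Ioi (0 : ℝ))
    isPreconnected_Ioi isOpen_Ioi ⟨1, Set.mem_Ioi.2 one_pos⟩ Filter.EventuallyEq.rfl
    (fun x hx => jlWeight_pos α β (ha.trans hx) (ne_of_gt hx)) hint2 hD
    (fun k hk => sub _ hint2 k (hL2 k hk) (hM2 k hk))
  have hst : s + t ≤ (L - M).roots := by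
    refine Multiset.le_iff_count.2 fun x => ?_
    rw [Multiset.count_add]
    by_cases hx : x ∈ s
    · have : x ∉ t := fun h => lt_asymm (hsI x hx).2 (htI x h)
      rw [Multiset.count_eq_zero_of_notMem this, add_zero]
      exact Multiset.le_iff_count.1 hs x
    · rw [Multiset.count_eq_zero_of_notMem hx, zero_add]
      exact Multiset.le_iff_count.1 ht x
  have hcard := Multiset.card_le_card hst
  rw [Multiset.card_add] at hcard
  have hroots : (Multiset.card (L - M).roots : WithBot ℕ) ≤ (L - M).degree := card_roots hD
  have hlt : (L - M).degree < L.degree := degree_sub_lt_left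
    (by rw [degree_eq_natDegree hmL.ne_zero, degree_eq_natDegree hmM.ne_zero, hdegL, hdegM])
    hmL.ne_zero (by rw [hmL, hmM])
  rw [degree_eq_natDegree hmL.ne_zero, hdegL] at hlt
  have : Multiset.card (L - M).roots < n + m := by exact_mod_cast hroots.trans_lt hlt
  omega

theorem monic_jlRaise (α β a : ℝ) {P : ℝ[X]} (hP : P.Monic) :
    (jlRaise α β a P).Monic ∧ (jlRaise α β a P).natDegree = P.natDegree + 2 := by
  have h0 : (X * (X - C a) : ℝ[X]).Monic := monic_X.mul (monic_X_sub_C a)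
  have hn0 : (X * (X - C a) : ℝ[X]).natDegree = 2 := by
    rw [monic_X.natDegree_mul (monic_X_sub_C a), natDegree_X, natDegree_X_sub_C]
  have h1 : (X * (X - C a) * P).Monic := h0.mul hP
  have hn1 : (X * (X - C a) * P).natDegree = P.natDegree + 2 := by
    rw [h0.natDegree_mul hP, hn0, add_comm]
  have h2 : ((C (α + 1) * X + C (β + 1) * (X - C a)) * P +
      X * (X - C a) * derivative P).degree < (X * (X - C a) * P).degree := by
    rw [degree_eq_natDegree h1.ne_zero, hn1]
    refine (degree_add_le _ _).trans_lt (max_lt ?_ ?_)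
    · refine (degree_le_natDegree).trans_lt ?_
      have : ((C (α + 1) * X + C (β + 1) * (X - C a)) * P).natDegree ≤ 1 + P.natDegree :=
        natDegree_mul_le_of_le (by compute_degree) le_rfl
      exact_mod_cast this.trans_lt (by omega)
    · rcases eq_or_ne (derivative P) 0 with hd | hd
      · rw [hd, mul_zero, degree_zero]
        exact WithBot.bot_lt_coe _
      · rw [degree_mul, degree_eq_natDegree h0.ne_zero, hn0]
        have := degree_derivative_lt hP.ne_zero
        rw [degree_eq_natDegree hP.ne_zero, degree_eq_natDegree hd] at this
        rw [degree_eq_natDegree hd]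
        have : (derivative P).natDegree < P.natDegree := by exact_mod_cast this
        have : 2 + (derivative P).natDegree < P.natDegree + 2 := by omega
        exact_mod_cast this
  have heq : jlRaise α β a P = X * (X - C a) * P - ((C (α + 1) * X + C (β + 1) * (X - C a)) * P +
      X * (X - C a) * derivative P) := by
    rw [jlRaise, sub_sub]
  rw [heq]
  exact ⟨h1.sub_of_left h2, by
    rw [natDegree_eq_of_degree_eq (degree_sub_eq_left_of_degree_lt h2), hn1]⟩

theorem IsJacobiLaguerre.jlRaise {n : ℕ} {α β a : ℝ} (ha : a < 0) (hα : -1 < α) (hβ : -1 < β)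
    {P : ℝ[X]} (hP : IsJacobiLaguerre n n (α + 1) (β + 1) a P) :
    IsJacobiLaguerre (n + 1) (n + 1) α β a (jlRaise α β a P) := by
  obtain ⟨h1, h2, h3, h4⟩ := isJacobiLaguerre_iff.1 hP
  obtain ⟨hm, hd⟩ := monic_jlRaise α β a h1
  refine isJacobiLaguerre_iff.2 ⟨hm, by rw [hd, h2]; ring, ?_, ?_⟩
  · exact integral_pow_mul_jlRaise (σ := -1) measurableSet_Ioc hα hβ (fun x hx => hx.1.le)
      (by norm_num) (fun x hx => by rw [abs_of_nonpos hx.2]; ring)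
      (fun P => (intervalIntegrable_iff_integrableOn_Ioc_of_le ha.le).1
        (intervalIntegrable_eval_mul_jlWeight ha hα hβ P le_rfl))
      (integral_Ioc_jlRaise_mul_jlWeight ha hα hβ) h3
  · exact integral_pow_mul_jlRaise (σ := 1) measurableSet_Ioi hα hβ
      (fun x hx => (ha.trans hx).le)
      (by norm_num) (fun x hx => by rw [abs_of_pos hx]; ring)
      (integrableOn_Ioi_eval_mul_jlWeight ha hα hβ)
      (integral_Ioi_jlRaise_mul_jlWeight ha hα hβ) h4

end

/-! ### Zeros as solutions of a partial fraction equation -/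

/-- The sequence `a, y 0, …, y (n - 1), 0, y n, y (n + 1), …`. -/
def jlPoles (a : ℝ) (n : ℕ) (y : ℕ → ℝ) (i : ℕ) : ℝ :=
  if i ≤ n then (if i = 0 then a else y (i - 1)) else if i = n + 1 then 0 else y (i - 2)

/-- The residues at `jlPoles` of the logarithmic derivative of `P (x - a)^(α+1) |x|^(β+1)`, where
`P` is the polynomial with simple zeros `y 0, …, y (2 * n - 1)`. -/
def jlMass (α β : ℝ) (n i : ℕ) : ℝ :=
  if i = 0 then α + 1 else if i = n + 1 then β + 1 else 1

theorem sum_jlMass_div (α β a : ℝ) (n : ℕ) (y : ℕ → ℝ) (z : ℝ) :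
    ∑ i ∈ Finset.range (2 * n + 2), jlMass α β n i / (z - jlPoles a n y i) =
      (α + 1) / (z - a) + (β + 1) / z + ∑ j ∈ Finset.range (2 * n), 1 / (z - y j) := by
  have h1 : ∑ i ∈ Finset.range n, jlMass α β n (i + 1) / (z - jlPoles a n y (i + 1)) =
      ∑ j ∈ Finset.range n, 1 / (z - y j) := by
    refine Finset.sum_congr rfl fun i hi => ?_
    have hi := Finset.mem_range.1 hi
    simp [jlMass, jlPoles, hi.ne, Nat.succ_le_of_lt hi]
  have h2 : ∑ i ∈ Finset.range n,
      jlMass α β n (n + 1 + (i + 1)) / (z - jlPoles a n y (n + 1 + (i + 1))) =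
      ∑ j ∈ Finset.range n, 1 / (z - y (n + j)) := by
    refine Finset.sum_congr rfl fun i hi => ?_
    have e1 : ¬ n + 1 + (i + 1) ≤ n := by omega
    have e2 : n + 1 + (i + 1) - 2 = n + i := by omega
    simp [jlMass, jlPoles, e1, e2]
  -- Two blocks of n + 1 poles, headed by a and by 0.
  rw [show 2 * n + 2 = (n + 1) + (n + 1) by ring, Finset.sum_range_add, Finset.sum_range_succ',
    Finset.sum_range_succ' (fun i => jlMass α β n (n + 1 + i) / (z - jlPoles a n y (n + 1 + i))),
    h1, h2, two_mul, Finset.sum_range_add]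
  simp [jlMass, jlPoles]
  ring

theorem exists_jlPoles_eq {n j : ℕ} (hj : j < 2 * n) (a : ℝ) (y : ℕ → ℝ) :
    ∃ i < 2 * n + 2, i ≠ 0 ∧ jlPoles a n y i = y j := by
  rcases lt_or_ge j n with h | h
  · exact ⟨j + 1, by omega, by omega, by simp [jlPoles, Nat.succ_le_of_lt h]⟩
  · refine ⟨j + 2, by omega, by omega, ?_⟩
    have e1 : ¬ j + 2 ≤ n := by omega
    have e2 : j ≠ n - 1 := by omega
    simp [jlPoles, e1]
    omega

/-- Dividing by z (z - a) P(z) turns P'/P into the sum of the 1/(z - y_j). -/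
theorem eval_jlRaise_prod (α β a : ℝ) {n : ℕ} {y : ℕ → ℝ} {z : ℝ}
    (hz : ∀ i < 2 * n + 2, z ≠ jlPoles a n y i) :
    (jlRaise α β a (∏ j ∈ Finset.range (2 * n), (X - C (y j)))).eval z =
      z * (z - a) * (∏ j ∈ Finset.range (2 * n), (z - y j)) *
      (1 - ∑ i ∈ Finset.range (2 * n + 2), jlMass α β n i / (z - jlPoles a n y i)) := by
  have ha : z - a ≠ 0 := sub_ne_zero.2 (by simpa [jlPoles] using hz 0 (by omega))
  have h0 : z ≠ 0 := by simpa [jlPoles] using hz (n + 1) (by omega)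
  have hy : ∀ j ∈ Finset.range (2 * n), z - y j ≠ 0 := by
    intro j hj
    obtain ⟨i, hi, -, h⟩ := exists_jlPoles_eq (Finset.mem_range.1 hj) a y
    rw [← h]
    exact sub_ne_zero.2 (hz i hi)
  have hd : (derivative (∏ j ∈ Finset.range (2 * n), (X - C (y j)))).eval z =
      (∏ j ∈ Finset.range (2 * n), (z - y j)) * ∑ j ∈ Finset.range (2 * n), 1 / (z - y j) := by
    rw [derivative_prod_finset, eval_finsetSum, Finset.mul_sum]
    refine Finset.sum_congr rfl fun j hj => ?_
    rw [← Finset.mul_prod_erase _ _ hj]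
    have := hy j hj
    simp only [eval_mul, eval_prod, eval_sub, eval_X, eval_C, derivative_X_sub_C, eval_one]
    field_simp
  rw [sum_jlMass_div]
  simp only [jlRaise, eval_sub, eval_mul, eval_add, eval_X, eval_C, hd, eval_prod]
  field_simp
  ring

theorem eq_prod_X_sub_C_of_eval_eq_zero {Q : ℝ[X]} (hQ : Q.Monic) {N : ℕ} (hN : Q.natDegree = N)
    {z : ℕ → ℝ} (hz : Set.InjOn z (Set.Iio N)) (h : ∀ i < N, Q.eval (z i) = 0) :
    Q = ∏ i ∈ Finset.range N, (X - C (z i)) := by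
  refine eq_of_monic_of_dvd_of_natDegree_le (monic_prod_X_sub_C z (Finset.range N)) hQ ?_ ?_
  · refine Finset.prod_dvd_of_coprime (fun i hi j hj hij => ?_)
      fun i hi => dvd_iff_isRoot.2 (h i (Finset.mem_range.1 hi))
    refine pairwise_coprime_X_sub_C (K := ℝ) (s := id) Function.injective_id ?_
    exact fun e => hij (hz (by simpa using hi) (by simpa using hj) e)
  · rw [hN, natDegree_finsetProd_X_sub_C_eq_card, Finset.card_range]

theorem strictMonoOn_of_jlPoles {a : ℝ} {n : ℕ} {y : ℕ → ℝ}
    (h : StrictMonoOn (jlPoles a n y) (Set.Iio (2 * n + 2))) :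
    StrictMonoOn y (Set.Iio (2 * n)) := by
  intro i hi j hj hij
  have hi : i < 2 * n := hi
  have hj : j < 2 * n := hj
  have key : ∀ k, jlPoles a n y (if k < n then k + 1 else k + 2) = y k := by
    intro k
    unfold jlPoles
    split_ifs <;> first | contradiction | omega | rfl
  rw [← key i, ← key j]
  refine h (Set.mem_Iio.2 ?_) (Set.mem_Iio.2 ?_) ?_ <;> split_ifs <;> omega

/-- The pole of index n + 1 is 0, so z 0, …, z n lie in (a, 0) and the remaining ones are positive:
inserting a and 0 gives the ordered poles of the next level. -/
theorem strictMonoOn_jlPoles_succ {a : ℝ} {n : ℕ} {y z : ℕ → ℝ}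
    (hlo : ∀ i < 2 * n + 2, jlPoles a n y i < z i)
    (hhi : ∀ i, i + 1 < 2 * n + 2 → z i < jlPoles a n y (i + 1)) :
    StrictMonoOn (jlPoles a (n + 1) z) (Set.Iio (2 * (n + 1) + 2)) := by
  have hz : ∀ i, i + 1 < 2 * n + 2 → z i < z (i + 1) := fun i hi => (hhi i hi).trans (hlo _ hi)
  refine strictMonoOn_of_lt_add_one Set.ordConnected_Iio fun i _ _ hi => ?_
  have hi : i + 1 < 2 * (n + 1) + 2 := hi
  have h0 : a < z 0 := by simpa [jlPoles] using hlo 0 (by omega)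
  have h1 : z n < 0 := by simpa [jlPoles] using hhi n (by omega)
  have h2 : 0 < z (n + 1) := by simpa [jlPoles] using hlo (n + 1) (by omega)
  rcases Nat.eq_zero_or_pos i with rfl | hpos
  · simpa [jlPoles] using h0
  rcases lt_trichotomy i (n + 1) with h | rfl | h
  · obtain ⟨k, rfl⟩ := Nat.exists_eq_add_of_le' hpos
    have e1 : k + 1 ≤ n := by omega
    have e2 : k ≤ n := by omega
    simpa [jlPoles, e1, e2] using hz k (by omega)
  · simpa [jlPoles] using h1
  · rcases eq_or_ne i (n + 2) with rfl | hne
    · simpa [jlPoles] using h2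
    · obtain ⟨k, rfl⟩ := Nat.exists_eq_add_of_le' (show 2 ≤ i by omega)
      have e1 : ¬ k + 2 ≤ n + 1 := by omega
      have e2 : ¬ k + 2 + 1 ≤ n + 1 := by omega
      have e3 : k + 2 ≠ n + 2 := hne
      have e4 : k ≠ n := by omega
      have e5 : ¬ k + 2 ≤ n := by omega
      have e6 : ¬ k + 1 = n := by omega
      have e7 : ¬ k + 1 ≤ n := by omega
      simpa [jlPoles, e1, e2, e3, e4, e5, e6, e7] using hz k (by omega)

theorem jlMass_pos {α β : ℝ} (hα : -1 < α) (hβ : -1 < β) (n i : ℕ) : 0 < jlMass α β n i := by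
  unfold jlMass
  split_ifs <;> linarith

/-- The ordering of the poles, which places n zeros on each side of 0, is carried along because the
next step needs it. β is generalized because that step calls on level β + 1. -/
theorem exists_zeros_isJacobiLaguerre {a : ℝ} (ha : a < 0) (n : ℕ) (β : ℝ) (hβ : -1 < β) :
    ∃ y : ℕ → ℝ → ℝ,
      (∀ α, -1 < α → StrictMonoOn (jlPoles a n (y · α)) (Set.Iio (2 * n + 2)) ∧
        IsJacobiLaguerre n n α β a (∏ j ∈ Finset.range (2 * n), (X - C (y j α)))) ∧
      ∀ j < 2 * n, StrictMonoOn (y j) (Set.Ioi (-1)) := by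
  induction n generalizing β with
  | zero =>
    refine ⟨fun _ _ => 0, fun α _ => ⟨?_, ?_⟩, by simp⟩
    · refine strictMonoOn_of_lt_add_one Set.ordConnected_Iio fun i _ _ hi => ?_
      have : i + 1 < 2 := hi
      obtain rfl : i = 0 := by omega
      simpa [jlPoles] using ha
    · exact ⟨by simp, by simp, by simp, by simp⟩
  | succ n ih =>
    obtain ⟨y, hy, hmono⟩ := ih (β + 1) (by linarith)
    have hy1 : ∀ α, -1 < α →
        StrictMonoOn (jlPoles a n (y · (α + 1))) (Set.Iio (2 * n + 2)) :=
      fun α hα => (hy (α + 1) (by linarith)).1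
    have hex : ∀ i α, ∃ z, -1 < α → i < 2 * n + 2 → jlPoles a n (y · (α + 1)) i < z ∧
        (i + 1 < 2 * n + 2 → z < jlPoles a n (y · (α + 1)) (i + 1)) ∧
        ∑ j ∈ Finset.range (2 * n + 2), jlMass α β n j / (z - jlPoles a n (y · (α + 1)) j) = 1 := by
      intro i α
      by_cases h : -1 < α ∧ i < 2 * n + 2
      · obtain ⟨z, hz⟩ := exists_sum_div_sub_eq_one (hy1 α h.1)
          (fun j _ => jlMass_pos h.1 hβ n j) h.2
        exact ⟨z, fun _ _ => hz⟩
      · exact ⟨0, fun h1 h2 => absurd ⟨h1, h2⟩ h⟩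
    choose z hz using hex
    refine ⟨z, fun α hα => ?_, fun i hi α hα α' hα' hlt => ?_⟩
    · have hpz : StrictMonoOn (jlPoles a (n + 1) (z · α)) (Set.Iio (2 * (n + 1) + 2)) :=
        strictMonoOn_jlPoles_succ (y := (y · (α + 1))) (fun i hi => (hz i α hα hi).1)
          fun i hi => (hz i α hα (by omega)).2.1 hi
      refine ⟨hpz, ?_⟩
      have hJ := (hy (α + 1) (by linarith)).2.jlRaise ha hα hβ
      rwa [eq_prod_X_sub_C_of_eval_eq_zero hJ.monic (N := 2 * (n + 1)) (z := (z · α))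
        (by rw [hJ.natDegree_eq]; ring) (strictMonoOn_of_jlPoles hpz).injOn fun i hi => ?_] at hJ
      obtain ⟨h1, h2, h3⟩ := hz i α hα hi
      rw [eval_jlRaise_prod, h3, sub_self, mul_zero]
      -- Being strictly inside its gap, z i is not a pole.
      intro j hj hcon
      rcases le_or_gt j i with hji | hji
      · have := (hy1 α hα).monotoneOn (Set.mem_Iio.2 hj) (Set.mem_Iio.2 hi) hji
        exact absurd h1 (by rw [hcon]; exact this.not_gt)
      · have hi' : i + 1 < 2 * n + 2 := by omega
        have := (hy1 α hα).monotoneOn (Set.mem_Iio.2 hi') (Set.mem_Iio.2 hj) hji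
        exact absurd (h2 hi') (by rw [hcon]; exact this.not_gt)
    · have hi : i < 2 * n + 2 := hi
      obtain ⟨h1, h2, h3⟩ := hz i α hα hi
      obtain ⟨h1', h2', h3'⟩ := hz i α' hα' hi
      refine lt_of_sum_div_sub_eq (hy1 α hα) (hy1 α' hα') (fun j _ => jlMass_pos hα hβ n j)
        (fun j hj => ?_) ?_ (fun j hj => ?_) hi h2 h1' h3 h3'
      -- Only the zeros of the previous level move, taken at α + 1 and α' + 1; a and 0 are fixed.
      · have hle : ∀ k < 2 * n, y k (α + 1) ≤ y k (α' + 1) := fun k hk =>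
          (hmono k hk (Set.mem_Ioi.2 (by linarith [Set.mem_Ioi.1 hα]))
            (Set.mem_Ioi.2 (by linarith [Set.mem_Ioi.1 hα'])) (by linarith)).le
        unfold jlPoles
        split_ifs
        · rfl
        · exact hle _ (by omega)
        · rfl
        · exact hle _ (by omega)
      · simpa [jlMass] using hlt
      · simp [jlMass, hj.ne']

theorem mainTheorem2 (n : ℕ) (a β : ℝ) (ha : a < 0) (hβ : -1 < β) :
    (∀ α : ℝ, -1 < α → ∃! L : ℝ[X], IsJacobiLaguerre n n α β a L) ∧
    ∃ x : Fin (2 * n) → ℝ → ℝ,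
      (∀ α : ℝ, -1 < α →
        StrictMono (fun j => x j α) ∧
        ∀ L : ℝ[X], IsJacobiLaguerre n n α β a L → L = ∏ j, (X - C (x j α))) ∧
      ∀ j, StrictMonoOn (x j) (Set.Ioi (-1)) := by
  obtain ⟨y, hy, hmono⟩ := exists_zeros_isJacobiLaguerre ha n β hβ
  refine ⟨fun α hα => ⟨_, (hy α hα).2, fun L hL => hL.unique ha hα hβ (hy α hα).2⟩,
    fun j => y j, fun α hα => ⟨fun i j hij => ?_, fun L hL => ?_⟩, fun j => hmono j j.2⟩
  · exact strictMonoOn_of_jlPoles (hy α hα).1 i.2 j.2 hij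
  · rw [hL.unique ha hα hβ (hy α hα).2, Finset.prod_range]
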